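/- Let $\alpha_2,p,q,a,b\in\mathbb C$ with $a\neq b$ and $p,q\notin\{a,b\}$. Put $$g_3(t)=t^3+\alpha_2t^2,\quad G_3(s,t)=g_3(s)-g_3(t),\quad p_a=\frac{G_3(p,a)}{p-a},\quad q_a=\frac{G_3(q,a)}{q-a},\quad a_b=\frac{G_3(a,b)}{a-b},$$ $$P=G_3(p,a),\quad Q=G_3(q,a),\quad b_0=G_3(a,b).$$ For a function $u(n,m,\alpha,\beta)$ on $\mathbb Z^4$ write $\widetilde u=u(n+1,\cdot)$, $\widehat u=u(\cdot,m+1,\cdot)$, $\dot u=u(\cdot,\beta+1)$ (forward shifts in $n$, $m$, $\beta$) and $\underset{\circ}{u}=u(\cdot,\alpha-1,\cdot)$ (backward shift in $\alpha$); shifts may be combined. The equations $C3_{b_0}$ are $C_1=C_2=C_3=0$ with $$C_1=\widetilde x-\widetilde y\,z-x,\qquad C_2=\widehat x-\widehat y\,z-x,\qquad C_3=\widehat{\widetilde z}\,y-b_0x-z\,\frac{P\,\widetilde y\,\widehat z-Q\,\widehat y\,\widetilde z}{\widetilde z-\widehat z}.$$ Let $$x_{a,b}=\frac1{b-a}\Big(\frac{p-b}{p-a}\Big)^n\Big(\frac{q-b}{q-a}\Big)^m,\quad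 z_b=(p-b)^n(q-b)^m,\quad y_a=-(p-a)^{-n}(q-a)^{-m}.$$ For $f:\mathbb Z^4\to\mathbb C$ define $$\mathcal C_1=(p-b)\,\dot{\underset{\circ}{\widetilde f}}\,f-(p-a)\,\dot{\underset{\circ}{f}}\,\widetilde f+(b-a)\,\dot f\,\underset{\circ}{\widetilde f},\qquad \mathcal C_2=(q-b)\,\dot{\underset{\circ}{\widehat f}}\,f-(q-a)\,\dot{\underset{\circ}{f}}\,\widehat f+(b-a)\,\dot f\,\underset{\circ}{\widehat f},$$ $$\mathcal C_3=(q-b)\,\widetilde f\,\dot{\widehat f}-(p-b)\,\widehat f\,\dot{\widetilde f}+(p-q)\,\widehat{\widetilde f}\,\dot f,$$ $$\mathcal C_4=(p-q)\,\dot{\widehat{\widetilde f}}\,\underset{\circ}{f}-\frac{(p-q)a_b}{(p-b)(q-b)}\,\widehat{\widetilde f}\,\dot{\underset{\circ}{f}}-T,\qquad T=\frac{p_a}{p-b}\,\dot{\widehat f}\,\underset{\circ}{\widetilde f}-\frac{q_a}{q-b}\,\dot{\widetilde f}\,\underset{\circ}{\widehat f}.$$ (i) Bilinearization. For every $f:\mathbb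 Z^4\to\mathbb C$, substitute $$x=x_{a,b}\frac{\dot{\underset{\circ}{f}}}{f},\qquad z=z_b\frac{\dot f}{f},\qquad y=y_a\frac{\underset{\circ}{f}}{f}.$$ Then, at every lattice point where the denominators that occur do not vanish (for $C_3$ this includes $p\ne q$ and $\widetilde z\neq\widehat z$), $$C_1=\frac{x_{a,b}\,\mathcal C_1}{(p-a)f\widetilde f},\qquad C_2=\frac{x_{a,b}\,\mathcal C_2}{(q-a)f\widehat f},$$ $$C_3=\frac{(p-b)(q-b)(b-a)\,x_{a,b}z_b}{(p-q)f\widetilde f\widehat f\,\widehat{\widetilde f}\,(\widetilde z-\widehat z)}\Big[\mathcal C_3\mathcal C_4+T\,\mathcal C_3-(p-q)\widehat{\widetilde f}\,\dot f\,\mathcal C_4\Big].$$ Consequently, at such points, $C_1=0\Leftrightarrow\mathcal C_1=0$, $C_2=0\Leftrightarrow\mathcal C_2=0$, and, if $\mathcal C_3=0$, then $C_3=0\Leftrightarrow\mathcal C_4=0$. In particular the bilinear system $\mathcal C_1=\mathcal C_2=\mathcal C_3=\mathcal C_4=0$ implies $C3_{b_0}$ there. (ii) Casoratian solutions. Let $N\ge0$,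 $\delta\in\mathbb C$, $k_j\in\mathbb C$ and $\varrho_{j,s}\in\mathbb C$ ($1\le j\le N$, $s=0,1,2$), and let $\omega_s(k_j)$ be roots of $g_3(\omega)=g_3(k_j)$ with $\omega_0(k_j)=k_j$, none of them equal to $p,q,a$ or $b$. Put $$\psi_j(l,n,m,\alpha,\beta)=\sum_{s=0}^2(\delta-\omega_s(k_j))^l(p-\omega_s(k_j))^n(q-\omega_s(k_j))^m(a-\omega_s(k_j))^\alpha(b-\omega_s(k_j))^\beta\varrho_{j,s}.$$ Then the Casoratian $f=|\widehat{N-1}|=\det\big(\psi_j(l,n,m,\alpha,\beta)\big)_{1\le j\le N,\;0\le l\le N-1}$ satisfies $\mathcal C_1=\mathcal C_2=\mathcal C_3=\mathcal C_4=0$ at every point of $\mathbb Z^4$ (with $0^0=1$, and $f=1$ for $N=0$). -/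

import Mathlib

/-- A function of the lattice variables `(n, m, α, β)`. -/
abbrev LatticeFun : Type := ℤ → ℤ → ℤ → ℤ → ℂ

/-- Tilde: forward shift in `n`. -/
def tilde (u : LatticeFun) : LatticeFun := fun n m α β => u (n + 1) m α β

/-- Hat: forward shift in `m`. -/
def hat (u : LatticeFun) : LatticeFun := fun n m α β => u n (m + 1) α β

/-- Circle below: backward shift in `α`. -/
def ucirc (u : LatticeFun) : LatticeFun := fun n m α β => u n m (α - 1) β

/-- Dot: forward shift in `β`. -/
def dot (u : LatticeFun) : LatticeFun := fun n m α β => u n m α (β + 1)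

/-- The cubic `g₃(t) = t³ + α₂ t²`. -/
def g3 (α₂ t : ℂ) : ℂ := t ^ 3 + α₂ * t ^ 2

/-- `G₃(s, t) = g₃(s) - g₃(t)`. -/
def G3 (α₂ s t : ℂ) : ℂ := g3 α₂ s - g3 α₂ t

/-- `s_t = G₃(s, t) / (s - t)`; this gives `p_a`, `q_a` and `a_b`. -/
noncomputable def quot3 (α₂ s t : ℂ) : ℂ := G3 α₂ s t / (s - t)

/-- Left-hand side of the first equation of `C3_{b₀}`. -/
def C3eq1 (x y z : LatticeFun) : LatticeFun := fun n m α β =>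
  tilde x n m α β - tilde y n m α β * z n m α β - x n m α β

/-- Left-hand side of the second equation of `C3_{b₀}`. -/
def C3eq2 (x y z : LatticeFun) : LatticeFun := fun n m α β =>
  hat x n m α β - hat y n m α β * z n m α β - x n m α β

/-- Left-hand side of the third equation of `C3_{b₀}`. -/
noncomputable def C3eq3 (P Q b₀ : ℂ) (x y z : LatticeFun) : LatticeFun := fun n m α β =>
  tilde (hat z) n m α β * y n m α β - b₀ * x n m α β
    - z n m α β *
      ((P * tilde y n m α β * hat z n m α β - Q * hat y n m α β * tilde z n m α β)
        / (tilde z n m α β - hat z n m α β))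

/-- Background `x_{a,b}`. -/
noncomputable def xBack (p q a b : ℂ) (n m : ℤ) : ℂ :=
  1 / (b - a) * ((p - b) / (p - a)) ^ n * ((q - b) / (q - a)) ^ m

/-- Background `z_b`. -/
noncomputable def zBack (p q b : ℂ) (n m : ℤ) : ℂ := (p - b) ^ n * (q - b) ^ m

/-- Background `y_a`. -/
noncomputable def yBack (p q a : ℂ) (n m : ℤ) : ℂ := -((p - a) ^ (-n) * (q - a) ^ (-m))

/-- The dependent variable `x` expressed through `f`. -/
noncomputable def xOf (p q a b : ℂ) (f : LatticeFun) : LatticeFun := fun n m α β =>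
  xBack p q a b n m * (dot (ucirc f) n m α β / f n m α β)

/-- The dependent variable `y` expressed through `f`. -/
noncomputable def yOf (p q a : ℂ) (f : LatticeFun) : LatticeFun := fun n m α β =>
  yBack p q a n m * (ucirc f n m α β / f n m α β)

/-- The dependent variable `z` expressed through `f`. -/
noncomputable def zOf (p q b : ℂ) (f : LatticeFun) : LatticeFun := fun n m α β =>
  zBack p q b n m * (dot f n m α β / f n m α β)

/-- First bilinear expression. -/
def bil1 (p a b : ℂ) (f : LatticeFun) : LatticeFun := fun n m α β =>
  (p - b) * tilde (dot (ucirc f)) n m α β * f n m α β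
    - (p - a) * dot (ucirc f) n m α β * tilde f n m α β
    + (b - a) * dot f n m α β * tilde (ucirc f) n m α β

/-- Second bilinear expression. -/
def bil2 (q a b : ℂ) (f : LatticeFun) : LatticeFun := fun n m α β =>
  (q - b) * hat (dot (ucirc f)) n m α β * f n m α β
    - (q - a) * dot (ucirc f) n m α β * hat f n m α β
    + (b - a) * dot f n m α β * hat (ucirc f) n m α β

/-- Third bilinear expression. -/
def bil3 (p q b : ℂ) (f : LatticeFun) : LatticeFun := fun n m α β =>
  (q - b) * tilde f n m α β * hat (dot f) n m α β
    - (p - b) * hat f n m α β * tilde (dot f) n m α β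
    + (p - q) * tilde (hat f) n m α β * dot f n m α β

/-- The two last terms of the fourth bilinear expression, with the opposite sign. -/
noncomputable def bil4Tail (α₂ p q a b : ℂ) (f : LatticeFun) : LatticeFun := fun n m α β =>
  quot3 α₂ p a / (p - b) * hat (dot f) n m α β * tilde (ucirc f) n m α β
    - quot3 α₂ q a / (q - b) * tilde (dot f) n m α β * hat (ucirc f) n m α β

/-- Fourth bilinear expression. -/
noncomputable def bil4 (α₂ p q a b : ℂ) (f : LatticeFun) : LatticeFun := fun n m α β =>
  (p - q) * tilde (hat (dot f)) n m α β * ucirc f n m α β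
    - (p - q) * quot3 α₂ a b / ((p - b) * (q - b))
      * tilde (hat f) n m α β * dot (ucirc f) n m α β
    - bil4Tail α₂ p q a b f n m α β

/-- The entry function `ψ_j(l, n, m, α, β)`, for one value of `j`. -/
noncomputable def psi (p q a b δ : ℂ) (ω ρ : Fin 3 → ℂ) (l n m α β : ℤ) : ℂ :=
  ∑ s : Fin 3, (δ - ω s) ^ l * (p - ω s) ^ n * (q - ω s) ^ m
    * (a - ω s) ^ α * (b - ω s) ^ β * ρ s

/-- The Casoratian `|0, 1, …, N - 1|` of `(ψ_1, …, ψ_N)`. -/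
noncomputable def casoratian (p q a b δ : ℂ) {N : ℕ} (ω ρ : Fin N → Fin 3 → ℂ) : LatticeFun :=
  fun n m α β =>
    (Matrix.of fun j l : Fin N => psi p q a b δ (ω j) (ρ j) ((l : ℕ) : ℤ) n m α β).det

/-! For (ii), read each row as a sequence in `l`, on which multiplication by `δ - ω` acts as the
index shift. Forward shifts in n, m, α, β are then `shiftSub` at the nodes δ-p, δ-q, δ-a, δ-b. Since
a Casoratian with shifted rows is, up to a Vandermonde factor, the unshifted one bordered by
geometric rows, every shifted `f` is a minor of one bordered matrix, and bilinear identities among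
minors follow from Laplace expansion with a repeated row or column. Three nodes give the Plücker
relation `seqDet_plucker`, hence the first three bilinear equations. The fourth is where the
dispersion relation enters: g₃(a) - g₃(ω) is a monic cubic in δ-ω and takes the same value at all
roots ω_s(k_j), so each row is an eigenvector of a cubic in the index shift. Applying this cubic to
the four-node matrix keeps the original rows proportional to themselves and multiplies each
geometric row by the cubic's value at its node (`seqDet_cubic`). For (i), the background of y is
-(b-a) times that of x over that of z, so each equation reduces to rational algebra. In the third,
𝒞₃ minus its last term is a multiple of z̃ - ẑ, which produces the bracket. -/

/-- The determinant of the first `N` terms of `N` sequences. -/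
noncomputable def seqDet {N : ℕ} (R : Fin N → ℕ → ℂ) : ℂ :=
  (Matrix.of fun i j : Fin N => R i j).det

/-- The sequence `i ↦ u (i + 1) - x * u i`; on moments this is multiplication by `t - x`. -/
def shiftSub (x : ℂ) (u : ℕ → ℂ) : ℕ → ℂ := fun i => u (i + 1) - x * u i

/-- The sequence of the powers of `x`. -/
def powSeq (x : ℂ) : ℕ → ℂ := fun i => x ^ i

/-! ### Bordering a determinant by geometric rows. -/

theorem shiftSub_comm (x y : ℂ) (u : ℕ → ℂ) :
    shiftSub x (shiftSub y u) = shiftSub y (shiftSub x u) := by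
  funext i; simp only [shiftSub]; ring

theorem shiftSub_powSeq (x y : ℂ) : shiftSub x (powSeq y) = (y - x) • powSeq y := by
  funext i; simp only [shiftSub, powSeq, Pi.smul_apply, smul_eq_mul]; ring

/-- Subtracting `x` times the preceding column from each column reduces the geometric row to (1, 0,
…, 0) and turns every other row into its `shiftSub`. -/
theorem seqDet_cons_powSeq {N : ℕ} (x : ℂ) (R : Fin N → ℕ → ℂ) :
    seqDet (Fin.cons (powSeq x) R : Fin (N + 1) → ℕ → ℂ) = seqDet fun i => shiftSub x (R i) := by
  set A : Matrix (Fin (N + 1)) (Fin (N + 1)) ℂ :=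
    Matrix.of fun i j => (Fin.cons (powSeq x) R : Fin (N + 1) → ℕ → ℂ) i j with hA
  set B : Matrix (Fin (N + 1)) (Fin (N + 1)) ℂ :=
    Matrix.of fun i j => Fin.cases (A i 0) (fun k => A i k.succ - x * A i k.castSucc) j with hB
  have h : A.det = B.det := by
    refine Matrix.det_eq_of_forall_col_eq_smul_add_pred (fun _ => x) (fun i => ?_) fun i j => ?_
    · simp [hB]
    · simp [hB]
  change A.det = _
  rw [h, Matrix.det_succ_row_zero, Fin.sum_univ_succ, Finset.sum_eq_zero, add_zero]
  · simp [hB, hA, powSeq, seqDet]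
    congr 1
  · intro j _
    simp [hB, hA, powSeq, pow_succ, mul_comm]

theorem seqDet_cons_smul {N : ℕ} (c : ℂ) (u : ℕ → ℂ) (R : Fin N → ℕ → ℂ) :
    seqDet (Fin.cons (c • u) R : Fin (N + 1) → ℕ → ℂ)
      = c * seqDet (Fin.cons u R : Fin (N + 1) → ℕ → ℂ) := by
  simp only [seqDet, Matrix.det_succ_row_zero, Finset.mul_sum]
  refine Finset.sum_congr rfl fun j _ => ?_
  simp only [Matrix.of_apply, Fin.cons_zero, Pi.smul_apply, smul_eq_mul]
  rw [show ((Matrix.of fun i j : Fin (N + 1) => (Fin.cons (c • u) R : Fin (N + 1) → ℕ → ℂ) i j).submatrix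
    Fin.succ j.succAbove) = ((Matrix.of fun i j : Fin (N + 1) =>
      (Fin.cons u R : Fin (N + 1) → ℕ → ℂ) i j).submatrix Fin.succ j.succAbove) from rfl]
  ring

theorem seqDet_cons_self {N : ℕ} (R : Fin N → ℕ → ℂ) (c : ℂ) (k : Fin N) :
    seqDet (Fin.cons (c • R k) R : Fin (N + 1) → ℕ → ℂ) = 0 := by
  rw [seqDet_cons_smul]
  refine mul_eq_zero_of_right _ (Matrix.det_zero_of_row_eq (Fin.succ_ne_zero k).symm ?_)
  funext j
  simp

theorem shiftSub_cons {N : ℕ} (x : ℂ) (u : ℕ → ℂ) (R : Fin N → ℕ → ℂ) :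
    (fun i => shiftSub x ((Fin.cons u R : Fin (N + 1) → ℕ → ℂ) i))
      = Fin.cons (shiftSub x u) fun i => shiftSub x (R i) := by
  funext i
  refine Fin.cases rfl (fun _ => rfl) i

theorem seqDet_cons_two {N : ℕ} (x y : ℂ) (R : Fin N → ℕ → ℂ) :
    seqDet (Fin.cons (powSeq x) (Fin.cons (powSeq y) R) : Fin (N + 2) → ℕ → ℂ)
      = (y - x) * seqDet fun i => shiftSub y (shiftSub x (R i)) := by
  rw [seqDet_cons_powSeq, shiftSub_cons, shiftSub_powSeq, seqDet_cons_smul, seqDet_cons_powSeq]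

theorem seqDet_cons_three {N : ℕ} (x y z : ℂ) (R : Fin N → ℕ → ℂ) :
    seqDet (Fin.cons (powSeq x) (Fin.cons (powSeq y) (Fin.cons (powSeq z) R)) :
        Fin (N + 3) → ℕ → ℂ)
      = (y - x) * (z - x) * (z - y)
        * seqDet fun i => shiftSub z (shiftSub y (shiftSub x (R i))) := by
  rw [seqDet_cons_powSeq, shiftSub_cons, shiftSub_cons, shiftSub_powSeq, shiftSub_powSeq,
    seqDet_cons_smul, seqDet_cons_powSeq, shiftSub_cons]
  rw [show shiftSub y ((z - x) • powSeq z) = ((z - x) * (z - y)) • powSeq z by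
    funext i; simp only [shiftSub, powSeq, Pi.smul_apply, smul_eq_mul]; ring]
  rw [seqDet_cons_smul, seqDet_cons_powSeq]
  ring

theorem seqDet_cons_four {N : ℕ} (x y z w : ℂ) (R : Fin N → ℕ → ℂ) :
    seqDet (Fin.cons (powSeq x) (Fin.cons (powSeq y) (Fin.cons (powSeq z)
        (Fin.cons (powSeq w) R))) : Fin (N + 4) → ℕ → ℂ)
      = (y - x) * (z - x) * (w - x) * ((z - y) * (w - y) * (w - z))
        * seqDet fun i => shiftSub w (shiftSub z (shiftSub y (shiftSub x (R i)))) := by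
  rw [seqDet_cons_powSeq, shiftSub_cons, shiftSub_cons, shiftSub_cons, shiftSub_powSeq,
    shiftSub_powSeq, shiftSub_powSeq, seqDet_cons_smul, seqDet_cons_powSeq, shiftSub_cons,
    shiftSub_cons]
  rw [show shiftSub y ((z - x) • powSeq z) = ((z - x) * (z - y)) • powSeq z by
    funext i; simp only [shiftSub, powSeq, Pi.smul_apply, smul_eq_mul]; ring,
    show shiftSub y ((w - x) • powSeq w) = ((w - x) * (w - y)) • powSeq w by
    funext i; simp only [shiftSub, powSeq, Pi.smul_apply, smul_eq_mul]; ring]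
  rw [seqDet_cons_smul, seqDet_cons_powSeq, shiftSub_cons]
  rw [show shiftSub z (((w - x) * (w - y)) • powSeq w)
      = ((w - x) * (w - y) * (w - z)) • powSeq w by
    funext i; simp only [shiftSub, powSeq, Pi.smul_apply, smul_eq_mul]; ring]
  rw [seqDet_cons_smul, seqDet_cons_powSeq]
  ring

/-! ### Laplace expansion and bilinear relations between minors. -/

/-- Laplace expansion along an arbitrary last column. -/
theorem sum_seqDet_succAbove {M : ℕ} (A : Fin (M + 1) → ℕ → ℂ) (c : Fin (M + 1) → ℂ) :
    ∑ r : Fin (M + 1), (-1) ^ (r : ℕ) * c r * seqDet (fun i => A (r.succAbove i))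
      = (-1) ^ M * (Matrix.of fun i j : Fin (M + 1) =>
          Fin.lastCases (motive := fun _ => ℂ) (c i) (fun k => A i k) j).det := by
  rw [Matrix.det_succ_column _ (Fin.last M), Finset.mul_sum]
  refine Finset.sum_congr rfl fun r _ => ?_
  have h : (Matrix.of fun i j : Fin (M + 1) =>
      Fin.lastCases (motive := fun _ => ℂ) (c i) (fun k => A i k) j).submatrix r.succAbove
        (Fin.last M).succAbove = Matrix.of fun i j : Fin M => A (r.succAbove i) j := by
    ext i j; simp
  rw [h, seqDet, Fin.val_last, pow_add]
  simp only [Matrix.of_apply, Fin.lastCases_last]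
  have : ((-1 : ℂ) ^ M) * (-1) ^ M = 1 := by rw [← mul_pow]; simp
  linear_combination (-(-1) ^ (r : ℕ) * c r
    * (Matrix.of fun i j : Fin M => A (r.succAbove i) j).det) * this

/-- The appended column repeats column `k`. -/
theorem sum_seqDet_succAbove_of_lt {M : ℕ} (A : Fin (M + 1) → ℕ → ℂ) {k : ℕ} (hk : k < M) :
    ∑ r : Fin (M + 1), (-1) ^ (r : ℕ) * A r k * seqDet (fun i => A (r.succAbove i)) = 0 := by
  rw [sum_seqDet_succAbove A fun r => A r k]
  refine mul_eq_zero_of_right _ (Matrix.det_zero_of_column_eq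
    (i := Fin.castSucc ⟨k, hk⟩) (j := Fin.last M) (Fin.castSucc_lt_last _).ne fun i => ?_)
  simp only [Matrix.of_apply, Fin.lastCases_castSucc, Fin.lastCases_last]

theorem sum_seqDet_succAbove_self {M : ℕ} (A : Fin (M + 1) → ℕ → ℂ) :
    ∑ r : Fin (M + 1), (-1) ^ (r : ℕ) * A r M * seqDet (fun i => A (r.succAbove i))
      = (-1) ^ M * seqDet A := by
  rw [sum_seqDet_succAbove A fun r => A r M, seqDet]
  congr 2
  ext i j
  refine Fin.lastCases ?_ (fun k => ?_) j <;> simp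

theorem sum_mul_seqDet_cons {M N : ℕ} (c : Fin M → ℂ) (v : Fin M → ℕ → ℂ) (L : Fin N → ℕ → ℂ) :
    ∑ r, c r * seqDet (Fin.cons (v r) L : Fin (N + 1) → ℕ → ℂ)
      = seqDet (Fin.cons (fun i => ∑ r, c r * v r i) L : Fin (N + 1) → ℕ → ℂ) := by
  simp only [seqDet, Matrix.det_succ_row_zero, Finset.mul_sum]
  rw [Finset.sum_comm]
  refine Finset.sum_congr rfl fun j _ => ?_
  simp only [Matrix.of_apply, Fin.cons_zero, Finset.mul_sum, Finset.sum_mul]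
  refine Finset.sum_congr rfl fun r _ => ?_
  rw [show ((Matrix.of fun i j : Fin (N + 1) =>
    (Fin.cons (v r) L : Fin (N + 1) → ℕ → ℂ) i j).submatrix Fin.succ j.succAbove)
    = ((Matrix.of fun i j : Fin (N + 1) => (Fin.cons (fun i => ∑ r, c r * v r i) L :
      Fin (N + 1) → ℕ → ℂ) i j).submatrix Fin.succ j.succAbove) from rfl]
  ring

theorem seqDet_cons_of_forall_lt {N : ℕ} (u : ℕ → ℂ) (hu : ∀ i < N, u i = 0)
    (L : Fin N → ℕ → ℂ) :
    seqDet (Fin.cons u L : Fin (N + 1) → ℕ → ℂ) = (-1) ^ N * u N * seqDet L := by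
  rw [seqDet, Matrix.det_succ_row_zero, Fin.sum_univ_castSucc, Finset.sum_eq_zero, zero_add]
  · have h : (Matrix.of fun i j : Fin (N + 1) =>
      (Fin.cons u L : Fin (N + 1) → ℕ → ℂ) i j).submatrix Fin.succ (Fin.last N).succAbove
        = Matrix.of fun i j : Fin N => L i j := by
      ext i j; simp
    rw [h]; simp [seqDet]
  · intro j _
    simp [hu j j.2]

theorem cons_succ_succAbove {n : ℕ} (u : ℕ → ℂ) (R : Fin (n + 1) → ℕ → ℂ) (r : Fin (n + 1)) :
    (fun i => (Fin.cons u R : Fin (n + 2) → ℕ → ℂ) (r.succ.succAbove i))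
      = Fin.cons u fun i => R (r.succAbove i) := by
  funext i
  refine Fin.cases ?_ (fun k => ?_) i <;> simp

/-- Three-term Plücker relation for the determinants with two additional nodes. -/
theorem seqDet_plucker (p q b : ℂ) {N : ℕ} (L : Fin N → ℕ → ℂ) :
    (q - b) * (seqDet fun i => shiftSub p (L i))
        * (seqDet fun i => shiftSub q (shiftSub b (L i)))
      - (p - b) * (seqDet fun i => shiftSub q (L i))
        * (seqDet fun i => shiftSub p (shiftSub b (L i)))
      + (p - q) * (seqDet fun i => shiftSub p (shiftSub q (L i)))
        * (seqDet fun i => shiftSub b (L i)) = 0 := by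
  set A : Fin (N + 3) → ℕ → ℂ :=
    Fin.cons (powSeq p) (Fin.cons (powSeq q) (Fin.cons (powSeq b) L)) with hA
  have h := sum_mul_seqDet_cons
    (fun r : Fin (N + 3) => (-1) ^ (r : ℕ) * seqDet (fun i => A (r.succAbove i))) A L
  -- The combined first row has entries of index at most `N`, all below the `N + 2` columns of the
  -- minors, so it vanishes identically.
  rw [seqDet_cons_of_forall_lt] at h
  rotate_left
  · intro i hi
    rw [← sum_seqDet_succAbove_of_lt A (k := i) (by omega)]
    exact Finset.sum_congr rfl fun r _ => by ring
  rw [show ∑ r : Fin (N + 3), (-1) ^ (r : ℕ) * seqDet (fun i => A (r.succAbove i)) * A r N = 0 by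
    rw [← sum_seqDet_succAbove_of_lt A (k := N) (by omega)]
    exact Finset.sum_congr rfl fun r _ => by ring] at h
  rw [Fin.sum_univ_succ, Fin.sum_univ_succ, Fin.sum_univ_succ, Finset.sum_eq_zero] at h
  rotate_left
  -- A row of `L` placed above `L` is repeated; only the three nodes contribute.
  · intro k _
    refine mul_eq_zero_of_right _ ?_
    simpa [hA] using seqDet_cons_self L 1 k
  simp only [hA, Fin.succAbove_zero, Fin.cons_succ, Fin.cons_zero, cons_succ_succAbove,
    Fin.val_succ, Fin.val_zero] at h
  simp only [seqDet_cons_two] at h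
  simp only [seqDet_cons_powSeq] at h
  simp only [shiftSub_comm b, shiftSub_comm q p] at h
  linear_combination -h

/-- Four-node relation for sequences that are eigenvectors of the multiplication by a monic cubic. -/
theorem seqDet_cubic (p q a b c₀ c₁ c₂ : ℂ) {N : ℕ} (L : Fin N → ℕ → ℂ) (ev : Fin N → ℂ)
    (hL : ∀ j i, L j (i + 3) + c₂ * L j (i + 2) + c₁ * L j (i + 1) + c₀ * L j i = ev j * L j i)
    (h : ℂ → ℂ) (hh : ∀ t, h t = t ^ 3 + c₂ * t ^ 2 + c₁ * t + c₀) :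
    h p * ((a - q) * (b - q) * (b - a)
        * seqDet fun i => shiftSub b (shiftSub a (shiftSub q (L i))))
        * (seqDet fun i => shiftSub p (L i))
      - h q * ((a - p) * (b - p) * (b - a)
        * seqDet fun i => shiftSub b (shiftSub a (shiftSub p (L i))))
        * (seqDet fun i => shiftSub q (L i))
      + h a * ((q - p) * (b - p) * (b - q)
        * seqDet fun i => shiftSub b (shiftSub q (shiftSub p (L i))))
        * (seqDet fun i => shiftSub a (L i))
      - h b * ((q - p) * (a - p) * (a - q)
        * seqDet fun i => shiftSub a (shiftSub q (shiftSub p (L i))))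
        * (seqDet fun i => shiftSub b (L i))
      = -((q - p) * (a - p) * (b - p) * ((a - q) * (b - q) * (b - a))
        * (seqDet fun i => shiftSub b (shiftSub a (shiftSub q (shiftSub p (L i)))))) * seqDet L := by
  set A : Fin (N + 4) → ℕ → ℂ :=
    Fin.cons (powSeq p) (Fin.cons (powSeq q) (Fin.cons (powSeq a) (Fin.cons (powSeq b) L)))
    with hA
  set V : Fin (N + 4) → ℕ → ℂ := fun r i =>
    A r (i + 3) + c₂ * A r (i + 2) + c₁ * A r (i + 1) + c₀ * A r i with hV
  have hpow (x : ℂ) : (fun i => powSeq x (i + 3) + c₂ * powSeq x (i + 2) + c₁ * powSeq x (i + 1)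
      + c₀ * powSeq x i) = h x • powSeq x := by
    funext i; simp only [powSeq, Pi.smul_apply, smul_eq_mul, hh]; ring
  have key := sum_mul_seqDet_cons
    (fun r : Fin (N + 4) => (-1) ^ (r : ℕ) * seqDet (fun i => A (r.succAbove i))) V L
  have hsum (i : ℕ) : ∑ r : Fin (N + 4), (-1) ^ (r : ℕ) * seqDet (fun i => A (r.succAbove i)) * V r i
      = (∑ r : Fin (N + 4), (-1) ^ (r : ℕ) * A r (i + 3) * seqDet (fun i => A (r.succAbove i)))
      + c₂ * (∑ r : Fin (N + 4), (-1) ^ (r : ℕ) * A r (i + 2) * seqDet (fun i => A (r.succAbove i)))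
      + c₁ * (∑ r : Fin (N + 4), (-1) ^ (r : ℕ) * A r (i + 1) * seqDet (fun i => A (r.succAbove i)))
      + c₀ * (∑ r : Fin (N + 4), (-1) ^ (r : ℕ) * A r i * seqDet (fun i => A (r.succAbove i))) := by
    simp only [Finset.mul_sum, ← Finset.sum_add_distrib]
    exact Finset.sum_congr rfl fun r _ => by simp only [hV]; ring
  -- The cubic raises the index by up to 3 and the minors have `N + 3` columns: entries with `i < N`
  -- vanish, while at `i = N` the leading term first reaches column `N + 3` and yields the full
  -- determinant of `A`.
  rw [seqDet_cons_of_forall_lt] at key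
  rotate_left
  · intro i hi
    rw [hsum, sum_seqDet_succAbove_of_lt A (k := i + 3) (by omega),
      sum_seqDet_succAbove_of_lt A (k := i + 2) (by omega),
      sum_seqDet_succAbove_of_lt A (k := i + 1) (by omega),
      sum_seqDet_succAbove_of_lt A (k := i) (by omega)]
    ring
  rw [hsum, sum_seqDet_succAbove_self, sum_seqDet_succAbove_of_lt A (k := N + 2) (by omega),
      sum_seqDet_succAbove_of_lt A (k := N + 1) (by omega),
      sum_seqDet_succAbove_of_lt A (k := N) (by omega)] at key
  rw [Fin.sum_univ_succ, Fin.sum_univ_succ, Fin.sum_univ_succ, Fin.sum_univ_succ,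
    Finset.sum_eq_zero] at key
  rotate_left
  · intro k _
    refine mul_eq_zero_of_right _ ?_
    -- Here the eigenvector hypothesis is used: the transformed row is still proportional to a row
    -- of `L`.
    rw [show V k.succ.succ.succ.succ = ev k • L k by
      funext i; simpa [hV, hA] using hL k i]
    exact seqDet_cons_self L _ k
  simp only [hV, hA, Fin.succAbove_zero, Fin.cons_succ, Fin.cons_zero, cons_succ_succAbove,
    Fin.val_succ, Fin.val_zero, hpow, seqDet_cons_smul] at key
  simp only [seqDet_cons_four] at key
  simp only [seqDet_cons_three] at key
  simp only [seqDet_cons_powSeq] at key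
  have hs : ((-1 : ℂ) ^ N) * (-1) ^ (N + 3) = -1 := by
    rw [pow_add, ← mul_assoc, ← mul_pow]; norm_num
  simp only [mul_zero, add_zero] at key
  linear_combination key + ((q - p) * (a - p) * (b - p) * ((a - q) * (b - q) * (b - a))
        * (seqDet fun i => shiftSub b (shiftSub a (shiftSub q (shiftSub p (L i)))))) * seqDet L * hs

/-! ### Lattice shifts of ψ and the Casoratian solutions. -/

/-- The sequence `l ↦ ψ(l, n, m, α, β)` over the natural numbers. -/
noncomputable def psiSeq (p q a b δ : ℂ) (ω ρ : Fin 3 → ℂ) (n m α β : ℤ) : ℕ → ℂ :=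
  fun l => psi p q a b δ ω ρ (l : ℤ) n m α β

section PsiSeq

variable {p q a b δ : ℂ} {ω ρ : Fin 3 → ℂ}

theorem psiSeq_add_one_n (h : ∀ s, p ≠ ω s) (n m α β : ℤ) :
    psiSeq p q a b δ ω ρ (n + 1) m α β
      = shiftSub (δ - p) (psiSeq p q a b δ ω ρ n m α β) := by
  funext l
  simp only [psiSeq, psi, shiftSub, Finset.mul_sum, ← Finset.sum_sub_distrib, zpow_natCast]
  refine Finset.sum_congr rfl fun s _ => ?_
  rw [zpow_add_one₀ (sub_ne_zero.2 (h s)), pow_succ]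
  ring

theorem psiSeq_add_one_m (h : ∀ s, q ≠ ω s) (n m α β : ℤ) :
    psiSeq p q a b δ ω ρ n (m + 1) α β
      = shiftSub (δ - q) (psiSeq p q a b δ ω ρ n m α β) := by
  funext l
  simp only [psiSeq, psi, shiftSub, Finset.mul_sum, ← Finset.sum_sub_distrib, zpow_natCast]
  refine Finset.sum_congr rfl fun s _ => ?_
  rw [zpow_add_one₀ (sub_ne_zero.2 (h s)), pow_succ]
  ring

theorem psiSeq_eq_shiftSub_α (h : ∀ s, a ≠ ω s) (n m α β : ℤ) :
    psiSeq p q a b δ ω ρ n m α β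
      = shiftSub (δ - a) (psiSeq p q a b δ ω ρ n m (α - 1) β) := by
  funext l
  simp only [psiSeq, psi, shiftSub, Finset.mul_sum, ← Finset.sum_sub_distrib, zpow_natCast]
  refine Finset.sum_congr rfl fun s _ => ?_
  rw [zpow_sub_one₀ (sub_ne_zero.2 (h s)), pow_succ]
  have := sub_ne_zero.2 (h s)
  field_simp
  ring

theorem psiSeq_add_one_β (h : ∀ s, b ≠ ω s) (n m α β : ℤ) :
    psiSeq p q a b δ ω ρ n m α (β + 1)
      = shiftSub (δ - b) (psiSeq p q a b δ ω ρ n m α β) := by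
  funext l
  simp only [psiSeq, psi, shiftSub, Finset.mul_sum, ← Finset.sum_sub_distrib, zpow_natCast]
  refine Finset.sum_congr rfl fun s _ => ?_
  rw [zpow_add_one₀ (sub_ne_zero.2 (h s)), pow_succ]
  ring

/-- The cubic recurrence in `l`: multiplication by `g₃(a) - g₃(ω)`, a monic cubic in `δ - ω`. -/
theorem psiSeq_cubic {α₂ k : ℂ} (h : ∀ s, g3 α₂ (ω s) = g3 α₂ k) (n m α β : ℤ) (i : ℕ) :
    psiSeq p q a b δ ω ρ n m α β (i + 3)
      + (-(3 * δ + α₂)) * psiSeq p q a b δ ω ρ n m α β (i + 2)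
      + (3 * δ ^ 2 + 2 * α₂ * δ) * psiSeq p q a b δ ω ρ n m α β (i + 1)
      + (g3 α₂ a - g3 α₂ δ) * psiSeq p q a b δ ω ρ n m α β i
      = (g3 α₂ a - g3 α₂ k) * psiSeq p q a b δ ω ρ n m α β i := by
  simp only [psiSeq, psi, Finset.mul_sum, ← Finset.sum_add_distrib, zpow_natCast]
  refine Finset.sum_congr rfl fun s _ => ?_
  rw [← h s]
  simp only [g3]
  ring

end PsiSeq

theorem casoratian_eq_seqDet (p q a b δ : ℂ) {N : ℕ} (ω ρ : Fin N → Fin 3 → ℂ) (n m α β : ℤ) :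
    casoratian p q a b δ ω ρ n m α β
      = seqDet fun j => psiSeq p q a b δ (ω j) (ρ j) n m α β := rfl

theorem casoratian_bil {α₂ p q a b δ : ℂ} (hab : a ≠ b)
    (hpa : p ≠ a) (hpb : p ≠ b) (hqa : q ≠ a) (hqb : q ≠ b) {N : ℕ}
    {k : Fin N → ℂ} {ω : Fin N → Fin 3 → ℂ} (ρ : Fin N → Fin 3 → ℂ)
    (hg : ∀ j s, g3 α₂ (ω j s) = g3 α₂ (k j))
    (hω : ∀ j s, p ≠ ω j s ∧ q ≠ ω j s ∧ a ≠ ω j s ∧ b ≠ ω j s) (n m α β : ℤ) :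
    bil1 p a b (casoratian p q a b δ ω ρ) n m α β = 0 ∧
    bil2 q a b (casoratian p q a b δ ω ρ) n m α β = 0 ∧
    bil3 p q b (casoratian p q a b δ ω ρ) n m α β = 0 ∧
    bil4 α₂ p q a b (casoratian p q a b δ ω ρ) n m α β = 0 := by
  have hp (n m α β : ℤ) (j : Fin N) := psiSeq_add_one_n (p := p) (q := q) (a := a) (b := b)
    (δ := δ) (ρ := ρ j) (fun s => (hω j s).1) n m α β
  have hq (n m α β : ℤ) (j : Fin N) := psiSeq_add_one_m (p := p) (q := q) (a := a) (b := b)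
    (δ := δ) (ρ := ρ j) (fun s => (hω j s).2.1) n m α β
  have ha (n m β : ℤ) (j : Fin N) := psiSeq_eq_shiftSub_α (p := p) (q := q) (a := a) (b := b)
    (δ := δ) (ρ := ρ j) (fun s => (hω j s).2.2.1) n m α β
  have hb (n m α β : ℤ) (j : Fin N) := psiSeq_add_one_β (p := p) (q := q) (a := a) (b := b)
    (δ := δ) (ρ := ρ j) (fun s => (hω j s).2.2.2) n m α β
  -- Basing the rows at α - 1 makes every shift that occurs a forward one.
  set L : Fin N → ℕ → ℂ := fun j => psiSeq p q a b δ (ω j) (ρ j) n m (α - 1) β with hL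
  refine ⟨?_, ?_, ?_, ?_⟩
  · have h := seqDet_plucker (δ - a) (δ - p) (δ - b) L
    simp only [bil1, tilde, dot, ucirc, casoratian_eq_seqDet, hp, hb, ha]
    simp only [hL, shiftSub_comm (δ - b), shiftSub_comm (δ - p) (δ - a)] at h ⊢
    linear_combination -h
  · have h := seqDet_plucker (δ - a) (δ - q) (δ - b) L
    simp only [bil2, hat, dot, ucirc, casoratian_eq_seqDet, hq, hb, ha]
    simp only [hL, shiftSub_comm (δ - b), shiftSub_comm (δ - q) (δ - a)] at h ⊢
    linear_combination -h
  · have h := seqDet_plucker (δ - p) (δ - q) (δ - b) fun j => shiftSub (δ - a) (L j)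
    simp only [bil3, tilde, hat, dot, casoratian_eq_seqDet, hp, hq, hb, ha]
    simp only [hL, shiftSub_comm (δ - b)] at h ⊢
    linear_combination -h
  -- The constant g₃(a) makes the cubic vanish at the node δ-a, which removes one of the five terms;
  -- at δ-p, δ-q, δ-b it equals -P, -Q, b₀.
  · have h := seqDet_cubic (δ - p) (δ - q) (δ - a) (δ - b) _ _ _ L _
      (fun j i => psiSeq_cubic (hg j) n m (α - 1) β i) (fun t => g3 α₂ a - g3 α₂ (δ - t))
      (fun t => by simp only [g3]; ring)
    simp only [bil4, bil4Tail, quot3, G3, tilde, hat, dot, ucirc, casoratian_eq_seqDet,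
      hp, hq, hb, ha]
    simp only [hL, sub_sub_cancel, shiftSub_comm (δ - b), shiftSub_comm (δ - q) (δ - p),
      shiftSub_comm (δ - a) (δ - p), shiftSub_comm (δ - a) (δ - q)] at h ⊢
    have h1 := sub_ne_zero.2 hab.symm
    have h2 := sub_ne_zero.2 hpa
    have h3 := sub_ne_zero.2 hpb
    have h4 := sub_ne_zero.2 hqa
    have h5 := sub_ne_zero.2 hqb
    linear_combination (norm := (field_simp; ring))
      (-1 / ((p - a) * (p - b) * (q - a) * (q - b) * (b - a))) * h

/-! ### Background factors and bilinearization. -/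

theorem xBack_ne_zero {p q a b : ℂ} (hab : a ≠ b) (hpa : p ≠ a) (hpb : p ≠ b) (hqa : q ≠ a)
    (hqb : q ≠ b) (n m : ℤ) : xBack p q a b n m ≠ 0 := by
  have h1 := sub_ne_zero.2 hab.symm
  have h2 := sub_ne_zero.2 hpa
  have h3 := sub_ne_zero.2 hpb
  have h4 := sub_ne_zero.2 hqa
  have h5 := sub_ne_zero.2 hqb
  exact mul_ne_zero (mul_ne_zero (one_div_ne_zero h1) (zpow_ne_zero _ (div_ne_zero h3 h2)))
    (zpow_ne_zero _ (div_ne_zero h5 h4))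

theorem zBack_ne_zero {p q b : ℂ} (hpb : p ≠ b) (hqb : q ≠ b) (n m : ℤ) :
    zBack p q b n m ≠ 0 :=
  mul_ne_zero (zpow_ne_zero _ (sub_ne_zero.2 hpb)) (zpow_ne_zero _ (sub_ne_zero.2 hqb))

section Back

variable {p q a b : ℂ}

theorem xBack_add_one_left (hpa : p ≠ a) (hpb : p ≠ b) (n m : ℤ) :
    xBack p q a b (n + 1) m = (p - b) / (p - a) * xBack p q a b n m := by
  simp only [xBack]
  rw [zpow_add_one₀ (div_ne_zero (sub_ne_zero.2 hpb) (sub_ne_zero.2 hpa))]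
  ring

theorem xBack_add_one_right (hqa : q ≠ a) (hqb : q ≠ b) (n m : ℤ) :
    xBack p q a b n (m + 1) = (q - b) / (q - a) * xBack p q a b n m := by
  simp only [xBack]
  rw [zpow_add_one₀ (div_ne_zero (sub_ne_zero.2 hqb) (sub_ne_zero.2 hqa))]
  ring

theorem zBack_add_one_left (hpb : p ≠ b) (n m : ℤ) :
    zBack p q b (n + 1) m = (p - b) * zBack p q b n m := by
  simp only [zBack, zpow_add_one₀ (sub_ne_zero.2 hpb)]
  ring

theorem zBack_add_one_right (hqb : q ≠ b) (n m : ℤ) :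
    zBack p q b n (m + 1) = (q - b) * zBack p q b n m := by
  simp only [zBack, zpow_add_one₀ (sub_ne_zero.2 hqb)]
  ring

theorem yBack_add_one_left (hpa : p ≠ a) (n m : ℤ) :
    yBack p q a (n + 1) m = yBack p q a n m / (p - a) := by
  simp only [yBack, neg_add, zpow_add₀ (sub_ne_zero.2 hpa), zpow_neg_one]
  ring

theorem yBack_add_one_right (hqa : q ≠ a) (n m : ℤ) :
    yBack p q a n (m + 1) = yBack p q a n m / (q - a) := by
  simp only [yBack, neg_add, zpow_add₀ (sub_ne_zero.2 hqa), zpow_neg_one]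
  ring

theorem yBack_eq (hab : a ≠ b) (hpb : p ≠ b) (hqb : q ≠ b) (n m : ℤ) :
    yBack p q a n m = -((b - a) * xBack p q a b n m / zBack p q b n m) := by
  have h1 := sub_ne_zero.2 hab.symm
  have h3 := zpow_ne_zero n (sub_ne_zero.2 hpb)
  have h5 := zpow_ne_zero m (sub_ne_zero.2 hqb)
  simp only [xBack, yBack, zBack, zpow_neg, div_zpow]
  field_simp

end Back

/-- The algebraic identity behind the bilinearization of the third equation: `A`, `B`, `C`, `D` are
the values of `f` shifted by nothing, tilde, hat and both, and the primed letters those of `f`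
with dot, with circle and with both. -/
theorem bilinearization_identity {p q a b Pq Qq aq X Z : ℂ} (hpa : p - a ≠ 0)
    (hpb : p - b ≠ 0) (hqa : q - a ≠ 0) (hqb : q - b ≠ 0) (hpq : p - q ≠ 0) (hZ : Z ≠ 0)
    {A B C D Ad Bd Cd Dd Ac Bc Cc Adc : ℂ} (hA : A ≠ 0) (hB : B ≠ 0) (hC : C ≠ 0) (hD : D ≠ 0)
    (hz : (p - b) * Z * (Bd / B) - (q - b) * Z * (Cd / C) ≠ 0) :
    (p - b) * ((q - b) * Z) * (Dd / D) * (-((b - a) * X / Z) * (Ac / A))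
      - (a - b) * aq * (X * (Adc / A))
      - Z * (Ad / A) * (((p - a) * Pq * (-((b - a) * X / Z) / (p - a) * (Bc / B))
            * ((q - b) * Z * (Cd / C))
          - (q - a) * Qq * (-((b - a) * X / Z) / (q - a) * (Cc / C)) * ((p - b) * Z * (Bd / B)))
        / ((p - b) * Z * (Bd / B) - (q - b) * Z * (Cd / C)))
      = (p - b) * (q - b) * (b - a) * X * Z
        / ((p - q) * A * B * C * D * ((p - b) * Z * (Bd / B) - (q - b) * Z * (Cd / C)))
        * (((q - b) * B * Cd - (p - b) * C * Bd + (p - q) * D * Ad)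
            * ((p - q) * Dd * Ac - (p - q) * aq / ((p - b) * (q - b)) * D * Adc
              - (Pq / (p - b) * Cd * Bc - Qq / (q - b) * Bd * Cc))
          + (Pq / (p - b) * Cd * Bc - Qq / (q - b) * Bd * Cc)
            * ((q - b) * B * Cd - (p - b) * C * Bd + (p - q) * D * Ad)
          - (p - q) * D * Ad * ((p - q) * Dd * Ac - (p - q) * aq / ((p - b) * (q - b)) * D * Adc
              - (Pq / (p - b) * Cd * Bc - Qq / (q - b) * Bd * Cc))) := by
  set W := (p - b) * Z * (Bd / B) - (q - b) * Z * (Cd / C) with hW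
  have hW' : (p - b) * C * Bd - (q - b) * B * Cd = W * B * C / Z := by
    rw [hW]; field_simp
  -- With κ = (p-q)·D·Ad, the bracket is (𝒞₃ - κ)(𝒞₄ + T) + κT, and 𝒞₃ - κ = -WBC/Z. Dividing by `W`
  -- gives the two polynomial terms from the first summand and the quotient term from the second.
  rw [show (q - b) * B * Cd - (p - b) * C * Bd + (p - q) * D * Ad
    = (p - q) * D * Ad - W * B * C / Z by rw [← hW']; ring]
  -- From here `W` is an independent nonzero quantity, so its definition does not enter the
  -- normalization.
  clear_value W
  field_simp
  ring

theorem C3eq1_of_tau {p q a b : ℂ} (hab : a ≠ b) (hpa : p ≠ a) (hpb : p ≠ b) (hqb : q ≠ b)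
    {f : LatticeFun} {n m α β : ℤ} (hf : f n m α β ≠ 0) (hft : tilde f n m α β ≠ 0) :
    C3eq1 (xOf p q a b f) (yOf p q a f) (zOf p q b f) n m α β
      = xBack p q a b n m * bil1 p a b f n m α β / ((p - a) * f n m α β * tilde f n m α β) := by
  have h2 := sub_ne_zero.2 hpa
  have hZ := zBack_ne_zero hpb hqb n m
  simp only [C3eq1, bil1, xOf, yOf, zOf, tilde, dot, ucirc, xBack_add_one_left hpa hpb,
    yBack_add_one_left hpa, yBack_eq hab hpb hqb] at hft ⊢
  field_simp
  ring

theorem C3eq2_of_tau {p q a b : ℂ} (hab : a ≠ b) (hqa : q ≠ a) (hpb : p ≠ b) (hqb : q ≠ b)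
    {f : LatticeFun} {n m α β : ℤ} (hf : f n m α β ≠ 0) (hfh : hat f n m α β ≠ 0) :
    C3eq2 (xOf p q a b f) (yOf p q a f) (zOf p q b f) n m α β
      = xBack p q a b n m * bil2 q a b f n m α β / ((q - a) * f n m α β * hat f n m α β) := by
  have h2 := sub_ne_zero.2 hqa
  have hZ := zBack_ne_zero hpb hqb n m
  simp only [C3eq2, bil2, xOf, yOf, zOf, hat, dot, ucirc, xBack_add_one_right hqa hqb,
    yBack_add_one_right hqa, yBack_eq hab hpb hqb] at hfh ⊢
  field_simp
  ring

theorem G3_eq_mul_quot3 {α₂ s t : ℂ} (h : s ≠ t) : G3 α₂ s t = (s - t) * quot3 α₂ s t := by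
  rw [quot3, mul_div_cancel₀ _ (sub_ne_zero.2 h)]

theorem C3eq3_of_tau {α₂ p q a b : ℂ} (hab : a ≠ b) (hpa : p ≠ a) (hpb : p ≠ b) (hqa : q ≠ a)
    (hqb : q ≠ b) (hpq : p ≠ q) {f : LatticeFun} {n m α β : ℤ} (hf : f n m α β ≠ 0)
    (hft : tilde f n m α β ≠ 0) (hfh : hat f n m α β ≠ 0) (hfth : tilde (hat f) n m α β ≠ 0)
    (hz : tilde (zOf p q b f) n m α β - hat (zOf p q b f) n m α β ≠ 0) :
    C3eq3 (G3 α₂ p a) (G3 α₂ q a) (G3 α₂ a b) (xOf p q a b f) (yOf p q a f) (zOf p q b f) n m α β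
      = (p - b) * (q - b) * (b - a) * xBack p q a b n m * zBack p q b n m
        / ((p - q) * f n m α β * tilde f n m α β * hat f n m α β * tilde (hat f) n m α β
          * (tilde (zOf p q b f) n m α β - hat (zOf p q b f) n m α β))
        * (bil3 p q b f n m α β * bil4 α₂ p q a b f n m α β
          + bil4Tail α₂ p q a b f n m α β * bil3 p q b f n m α β
          - (p - q) * tilde (hat f) n m α β * dot f n m α β * bil4 α₂ p q a b f n m α β) := by
  simp only [C3eq3, bil3, bil4, bil4Tail, xOf, yOf, zOf, hat, tilde, dot, ucirc,
    yBack_add_one_left hpa, yBack_add_one_right hqa, zBack_add_one_left hpb,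
    zBack_add_one_right hqb, yBack_eq hab hpb hqb, G3_eq_mul_quot3 hpa, G3_eq_mul_quot3 hqa,
    G3_eq_mul_quot3 hab] at hft hfh hfth hz ⊢
  exact bilinearization_identity (sub_ne_zero.2 hpa) (sub_ne_zero.2 hpb) (sub_ne_zero.2 hqa)
    (sub_ne_zero.2 hqb) (sub_ne_zero.2 hpq) (zBack_ne_zero hpb hqb n m) hf hft hfh hfth hz

/-- If ḟ vanished, 𝒞₃ = 0 would force z̃ = ẑ. So the factor ḟ multiplying 𝒞₄ in the third equation
can be cancelled without a separate assumption. -/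
theorem dot_ne_zero_of_bil3 {p q b : ℂ} (hpb : p ≠ b) (hqb : q ≠ b)
    {f : LatticeFun} {n m α β : ℤ} (hft : tilde f n m α β ≠ 0) (hfh : hat f n m α β ≠ 0)
    (hz : tilde (zOf p q b f) n m α β - hat (zOf p q b f) n m α β ≠ 0)
    (h3 : bil3 p q b f n m α β = 0) : dot f n m α β ≠ 0 := by
  intro h0
  apply hz
  simp only [bil3, zOf, hat, tilde, dot, zBack_add_one_left hpb, zBack_add_one_right hqb]
    at hft hfh h3 h0 ⊢
  rw [h0] at h3
  field_simp
  linear_combination -(zBack p q b n m) * h3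

theorem mainTheorem4 (α₂ p q a b : ℂ) (hab : a ≠ b)
    (hpa : p ≠ a) (hpb : p ≠ b) (hqa : q ≠ a) (hqb : q ≠ b) :
    (∀ (f x y z : LatticeFun),
      x = xOf p q a b f → y = yOf p q a f → z = zOf p q b f →
      ∀ n m α β : ℤ, f n m α β ≠ 0 →
        (tilde f n m α β ≠ 0 →
          C3eq1 x y z n m α β
              = xBack p q a b n m * bil1 p a b f n m α β
                / ((p - a) * f n m α β * tilde f n m α β) ∧
          (C3eq1 x y z n m α β = 0 ↔ bil1 p a b f n m α β = 0)) ∧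
        (hat f n m α β ≠ 0 →
          C3eq2 x y z n m α β
              = xBack p q a b n m * bil2 q a b f n m α β
                / ((q - a) * f n m α β * hat f n m α β) ∧
          (C3eq2 x y z n m α β = 0 ↔ bil2 q a b f n m α β = 0)) ∧
        (p ≠ q → tilde f n m α β ≠ 0 → hat f n m α β ≠ 0 → tilde (hat f) n m α β ≠ 0 →
          tilde z n m α β - hat z n m α β ≠ 0 →
          C3eq3 (G3 α₂ p a) (G3 α₂ q a) (G3 α₂ a b) x y z n m α β
              = (p - b) * (q - b) * (b - a) * xBack p q a b n m * zBack p q b n m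
                / ((p - q) * f n m α β * tilde f n m α β * hat f n m α β
                    * tilde (hat f) n m α β * (tilde z n m α β - hat z n m α β))
                * (bil3 p q b f n m α β * bil4 α₂ p q a b f n m α β
                    + bil4Tail α₂ p q a b f n m α β * bil3 p q b f n m α β
                    - (p - q) * tilde (hat f) n m α β * dot f n m α β
                      * bil4 α₂ p q a b f n m α β) ∧
          (bil3 p q b f n m α β = 0 →
            (C3eq3 (G3 α₂ p a) (G3 α₂ q a) (G3 α₂ a b) x y z n m α β = 0 ↔
              bil4 α₂ p q a b f n m α β = 0)))) ∧
    (∀ (N : ℕ) (δ : ℂ) (k : Fin N → ℂ) (ω ρ : Fin N → Fin 3 → ℂ),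
      (∀ j, ω j 0 = k j) →
      (∀ j s, g3 α₂ (ω j s) = g3 α₂ (k j)) →
      (∀ j s, p ≠ ω j s ∧ q ≠ ω j s ∧ a ≠ ω j s ∧ b ≠ ω j s) →
      ∀ n m α β : ℤ,
        bil1 p a b (casoratian p q a b δ ω ρ) n m α β = 0 ∧
        bil2 q a b (casoratian p q a b δ ω ρ) n m α β = 0 ∧
        bil3 p q b (casoratian p q a b δ ω ρ) n m α β = 0 ∧
        bil4 α₂ p q a b (casoratian p q a b δ ω ρ) n m α β = 0) := by
  have h2 := sub_ne_zero.2 hpa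
  have h4 := sub_ne_zero.2 hqa
  have hX := xBack_ne_zero hab hpa hpb hqa hqb
  constructor
  · rintro f _ _ _ rfl rfl rfl n m α β hf
    refine ⟨fun hft => ?_, fun hfh => ?_, fun hpq hft hfh hfth hz => ?_⟩
    · have h := C3eq1_of_tau hab hpa hpb hqb hf hft
      refine ⟨h, ?_⟩
      simp [h, hX, h2, hf, hft]
    · have h := C3eq2_of_tau hab hqa hpb hqb hf hfh
      refine ⟨h, ?_⟩
      simp [h, hX, h4, hf, hfh]
    · have h := C3eq3_of_tau (α₂ := α₂) hab hpa hpb hqa hqb hpq hf hft hfh hfth hz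
      refine ⟨h, fun h3 => ?_⟩
      have hd := dot_ne_zero_of_bil3 hpb hqb hft hfh hz h3
      rw [h, h3]
      simp [hX, zBack_ne_zero hpb hqb, sub_ne_zero.2 hpb, sub_ne_zero.2 hqb,
        sub_ne_zero.2 hab.symm, sub_ne_zero.2 hpq, hf, hft, hfh, hfth, hz, hd]
  · intro N δ k ω ρ _ hg hω n m α β
    exact casoratian_bil hab hpa hpb hqa hqb ρ hg hω n m α β
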